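/- Let $\sigma$ be a positive Borel measure on $\mathbb R$ with $\int_{\mathbb R}(u^2+1)^{-N}\,d\sigma(u)<\infty$ for some $N\in\mathbb N_0$. Let $\mathcal H=\mathbf L_2(d\sigma)$ be the real Hilbert space of real-valued square-integrable functions, let $\mathcal H_{\mathbb C}$ be its complexification (the complex-valued square-integrable functions), and let $$\Gamma_\sigma=\bigoplus_{n=0}^\infty \mathcal H_{\mathbb C}^{\otimes n},\qquad \mathcal H_{\mathbb C}^{\otimes 0}=\mathbb C\Omega,\quad \|\Omega\|=1,$$ be the full Fock space (Hilbert space tensor products and direct sum). For $h\in\mathcal H$ let $\ell_h f=h\otimes f$ $(f\in\Gamma_\sigma)$ and $T_h=\ell_h+\ell_h^*$. Let $\mathcal M=\{T_h:h\in\mathcal H\}''$ be the von Neumann algebra generated by the operators $T_h$, $h\in\mathcal H$, let $\tau(x)=\langle\Omega,x\Omega\rangle$ for $x\in\mathcal M$, and let $\mathbf L_2(\tau)$ be the Hilbert space completion of $\mathcal M$ with respect to $\langle x,y\rangle_\tau=\tau(x^*y)$. Let $U_n$ be the Chebyshev polynomials of the second kind, $U_n(\cos\theta)=\sin((n+1)\theta)/\sin\theta$.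 Theorem. Let $(h_i)_{i\in I}$ be any orthonormal basis of the real Hilbert space $\mathbf L_2(d\sigma)$ (so one may take $I=\mathbb N_0$ when $\mathbf L_2(d\sigma)$ is infinite-dimensional). Then the elements $$U_\alpha=U_{\alpha_1}\!\left(\tfrac12T_{h_{i_1}}\right)U_{\alpha_2}\!\left(\tfrac12T_{h_{i_2}}\right)\cdots U_{\alpha_k}\!\left(\tfrac12T_{h_{i_k}}\right)\in\mathcal M,$$ where $\alpha=z_{i_1}^{\alpha_1}z_{i_2}^{\alpha_2}\cdots z_{i_k}^{\alpha_k}$ runs over the free monoid generated by letters $z_i$ $(i\in I)$, each element being written in reduced form ($k\ge 0$, $\alpha_j\ge 1$, $i_j\ne i_{j+1}$; for $k=0$, $U_\alpha=1$), form an orthonormal basis of $\mathbf L_2(\tau)$, indexed by $\alpha$. -/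

import Mathlib

open MeasureTheory UniformSpace
open scoped TensorProduct ENNReal

noncomputable section

namespace FreeFock

/-! ### The full Fock space of a complex Hilbert space -/

/-- A complex Hilbert space, bundled (used only to define tensor powers by recursion). -/
structure HilbertC where
  carrier : Type
  [normed : NormedAddCommGroup carrier]
  [inner : InnerProductSpace ℂ carrier]
  [complete : CompleteSpace carrier]

attribute [instance] HilbertC.normed HilbertC.inner HilbertC.complete

section Fock

variable (K : Type) [NormedAddCommGroup K] [InnerProductSpace ℂ K]

/-- The tensor powers `K^{⊗ n}` as Hilbert spaces: `K^{⊗ 0} = ℂ`, and `K^{⊗ (n+1)}` is the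
completed Hilbert space tensor product of `K` with `K^{⊗ n}`. -/
def tensorPowC : ℕ → HilbertC
  | 0 => ⟨ℂ⟩
  | n + 1 => ⟨Completion (K ⊗[ℂ] (tensorPowC n).carrier)⟩

/-- The underlying type of the `n`-th Hilbert space tensor power `K^{⊗ n}`. -/
abbrev TensorPow (n : ℕ) : Type := (tensorPowC K n).carrier

/-- The full Fock space `Γ(K) = ⨁_{n ≥ 0} K^{⊗ n}` (Hilbert space direct sum). -/
abbrev Fock : Type := lp (fun n : ℕ => TensorPow K n) 2

variable {K}

/-- The operator `f ↦ k ⊗ f` from `K^{⊗ n}` to `K^{⊗ (n+1)}`. -/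
def tensorLeft (k : K) (n : ℕ) : TensorPow K n →L[ℂ] TensorPow K (n + 1) :=
  (Completion.toComplL : (K ⊗[ℂ] TensorPow K n) →L[ℂ] Completion (K ⊗[ℂ] TensorPow K n)) ∘L
    (TensorProduct.mkL ℂ K (TensorPow K n) k)

theorem norm_tensorLeft (k : K) (n : ℕ) (x : TensorPow K n) :
    ‖tensorLeft k n x‖ = ‖k‖ * ‖x‖ := by
  change ‖((k ⊗ₜ[ℂ] x : K ⊗[ℂ] TensorPow K n) : Completion (K ⊗[ℂ] TensorPow K n))‖ = _
  rw [Completion.norm_coe, TensorProduct.norm_tmul]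

/-- The components of `ℓ_k f`: zero in degree `0`, and `k ⊗ f_n` in degree `n + 1`. -/
def creationSeq (k : K) (f : ∀ n : ℕ, TensorPow K n) : ∀ n : ℕ, TensorPow K n
  | 0 => 0
  | n + 1 => tensorLeft k n (f n)

theorem hasSum_creationSeq (k : K) (f : Fock K) :
    HasSum (fun n => ‖creationSeq k f n‖ ^ (2 : ℝ≥0∞).toReal)
      ((‖k‖ * ‖f‖) ^ (2 : ℝ≥0∞).toReal) := by
  have hf := (lp.hasSum_norm (p := 2) (by simp) f).mul_left (‖k‖ ^ (2 : ℝ≥0∞).toReal)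
  rw [Real.mul_rpow (norm_nonneg _) (norm_nonneg _)]
  refine (hasSum_nat_add_iff' 1).mp ?_
  simpa [creationSeq, norm_tensorLeft, mul_pow] using hf

/-- The (left) creation operator `ℓ_k f = k ⊗ f` on the full Fock space. -/
def creation (k : K) : Fock K →L[ℂ] Fock K :=
  LinearMap.mkContinuous
    { toFun := fun f => ⟨creationSeq k f,
        memℓp_gen (hasSum_creationSeq k f).summable⟩
      map_add' := fun f g => by
        ext n
        cases n with
        | zero => exact (add_zero 0).symm
        | succ n => exact map_add (tensorLeft k n) (f n) (g n)
      map_smul' := fun c f => by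
        ext n
        cases n with
        | zero => simp [creationSeq]
        | succ n => simp [creationSeq] }
    ‖k‖ fun f => by
      refine lp.norm_le_of_tsum_le (by simp) (by positivity) ?_
      exact (hasSum_creationSeq k f).tsum_eq.le

/-- The field (semicircular) operator `T_k = ℓ_k + ℓ_k^*`. -/
def fieldOp (k : K) : Fock K →L[ℂ] Fock K :=
  creation k + ContinuousLinearMap.adjoint (creation k)

variable (K) in
/-- The unit vector `1` of `K^{⊗ 0} = ℂ`. -/
def tensorUnit : TensorPow K 0 := (1 : ℂ)

variable (K) in
/-- The vacuum vector `Ω`, i.e. the vector `1` of `K^{⊗ 0} = ℂ` placed in degree `0`. -/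
def vacuum : Fock K := lp.single 2 0 (tensorUnit K)

end Fock

/-! ### Generated von Neumann algebras and the `L₂` space of a vector state -/

section VN

universe u
variable {E : Type u} [NormedAddCommGroup E] [InnerProductSpace ℂ E] [CompleteSpace E]

/-- The von Neumann algebra generated by a set `S` of bounded operators: the double commutant
of `S ∪ S^*`. -/
def generatedVN (S : Set (E →L[ℂ] E)) : VonNeumannAlgebra E where
  toStarSubalgebra :=
    StarSubalgebra.centralizer ℂ (StarSubalgebra.centralizer ℂ S : Set (E →L[ℂ] E))
  centralizer_centralizer' := by
    change Set.centralizer (Set.centralizer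
      (StarSubalgebra.centralizer ℂ (StarSubalgebra.centralizer ℂ S : Set (E →L[ℂ] E)) :
        Set (E →L[ℂ] E))) =
      (StarSubalgebra.centralizer ℂ (StarSubalgebra.centralizer ℂ S : Set (E →L[ℂ] E)) :
        Set (E →L[ℂ] E))
    simp

theorem subset_generatedVN (S : Set (E →L[ℂ] E)) {x : E →L[ℂ] E} (hx : x ∈ S) :
    x ∈ (generatedVN S).toStarSubalgebra :=
  StarAlgebra.adjoin_le_centralizer_centralizer ℂ S (StarAlgebra.subset_adjoin ℂ S hx)

/-- The vector functional `x ↦ ⟨ω, x ω⟩` on a von Neumann algebra. -/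
def vectorState (M : VonNeumannAlgebra E) (ω : E) (x : M.toStarSubalgebra) : ℂ :=
  inner ℂ ω ((x : E →L[ℂ] E) ω)

/-- A copy of the von Neumann algebra `M`, to be equipped with the (semi-)inner product
`⟨x, y⟩ = τ(x^* y)`, where `τ` is the vector state of `ω`. -/
@[nolint unusedArguments]
def PreL2 (M : VonNeumannAlgebra E) (_ω : E) : Type u := M.toStarSubalgebra

instance (M : VonNeumannAlgebra E) (ω : E) : AddCommGroup (PreL2 M ω) :=
  inferInstanceAs (AddCommGroup M.toStarSubalgebra)

instance (M : VonNeumannAlgebra E) (ω : E) : Module ℂ (PreL2 M ω) :=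
  inferInstanceAs (Module ℂ M.toStarSubalgebra)

/-- The identity map from `M` to `PreL2 M ω`. -/
def toPreL2 (M : VonNeumannAlgebra E) (ω : E) : M.toStarSubalgebra ≃ₗ[ℂ] PreL2 M ω :=
  LinearEquiv.refl ℂ _

theorem vectorState_star_mul (M : VonNeumannAlgebra E) (ω : E) (x y : M.toStarSubalgebra) :
    vectorState M ω (star x * y) = inner ℂ ((x : E →L[ℂ] E) ω) ((y : E →L[ℂ] E) ω) := by
  simp [vectorState, ContinuousLinearMap.star_eq_adjoint,
    ContinuousLinearMap.adjoint_inner_right]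

/-- The semi-inner product `⟨x, y⟩ = τ(x^* y)` on `M`. -/
abbrev preL2Core (M : VonNeumannAlgebra E) (ω : E) :
    PreInnerProductSpace.Core ℂ (PreL2 M ω) where
  inner x y := vectorState M ω (star ((toPreL2 M ω).symm x) * (toPreL2 M ω).symm y)
  conj_inner_symm x y := by simp only [vectorState_star_mul, inner_conj_symm]
  re_inner_nonneg x := by
    simp only [vectorState_star_mul]
    exact inner_self_nonneg
  add_left x y z := by
    rw [vectorState_star_mul, vectorState_star_mul, vectorState_star_mul, map_add]
    exact inner_add_left _ _ _
  smul_left x y c := by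
    rw [vectorState_star_mul, vectorState_star_mul, map_smul]
    exact inner_smul_left _ _ _

instance (M : VonNeumannAlgebra E) (ω : E) : SeminormedAddCommGroup (PreL2 M ω) :=
  InnerProductSpace.Core.toSeminormedAddCommGroup (c := preL2Core M ω)

instance (M : VonNeumannAlgebra E) (ω : E) : InnerProductSpace ℂ (PreL2 M ω) :=
  InnerProductSpace.ofCore (preL2Core M ω)

/-- The Hilbert space `L₂(τ)`: the (Hausdorff) completion of `M` for `⟨x, y⟩ = τ(x^* y)`, where
`τ` is the vector state of `ω`. -/
abbrev L2 (M : VonNeumannAlgebra E) (ω : E) : Type u := Completion (PreL2 M ω)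

/-- The canonical map `M → L₂(τ)`. -/
def toL2 (M : VonNeumannAlgebra E) (ω : E) (x : M.toStarSubalgebra) : L2 M ω :=
  (toPreL2 M ω x : Completion (PreL2 M ω))

end VN

/-! ### The semicircular system over `L₂(σ)` -/

section Semicircular

variable (σ : Measure ℝ)

/-- The embedding of the real Hilbert space `L₂(σ; ℝ)` into its complexification `L₂(σ; ℂ)`. -/
def complexify : Lp ℝ 2 σ →L[ℝ] Lp ℂ 2 σ := Complex.ofRealCLM.compLpL 2 σ

/-- The full Fock space `Γ_σ` over (the complexification of) the real Hilbert space `L₂(σ)`. -/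
abbrev FockSigma : Type := Fock (Lp ℂ 2 σ)

variable {σ} in
/-- The operator `T_h = ℓ_h + ℓ_h^*` on `Γ_σ`, for `h` in the real Hilbert space `L₂(σ)`. -/
def semicircular (h : Lp ℝ 2 σ) : FockSigma σ →L[ℂ] FockSigma σ := fieldOp (complexify σ h)

/-- The von Neumann algebra `M` generated by the operators `T_h`, `h` in the real Hilbert space
`L₂(σ)`. -/
def freeAlg : VonNeumannAlgebra (FockSigma σ) :=
  generatedVN (Set.range (semicircular (σ := σ)))

/-- `L₂(τ)` for `M` and the vacuum state `τ = ⟨Ω, · Ω⟩`. -/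
abbrev L2tau : Type := L2 (freeAlg σ) (vacuum (Lp ℂ 2 σ))

variable {σ}

/-- `T_h` as an element of `M`. -/
def semicircularElt (h : Lp ℝ 2 σ) : (freeAlg σ).toStarSubalgebra :=
  ⟨semicircular h, subset_generatedVN _ ⟨h, rfl⟩⟩

/-- The reduced words `z_{i_1}^{α_1} ⋯ z_{i_k}^{α_k}` of the free monoid on letters `z_i`,
`i : ι`: lists of pairs `(i_j, α_j)` with `α_j ≥ 1` and `i_j ≠ i_{j+1}`. The empty list is the
unit of the monoid. -/
def ReducedWord (ι : Type*) : Type _ :=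
  {w : List (ι × ℕ+) // w.IsChain (fun a b => a.1 ≠ b.1)}

/-- `U_α = U_{α_1}(½ T_{h_{i_1}}) ⋯ U_{α_k}(½ T_{h_{i_k}})`, an element of `M`; here `U_n` is the
Chebyshev polynomial of the second kind, `U_n(cos θ) = sin((n+1)θ) / sin θ`. -/
def chebyshevWord {ι : Type*} (h : ι → Lp ℝ 2 σ) (α : ReducedWord ι) :
    (freeAlg σ).toStarSubalgebra :=
  (α.1.map fun p => Polynomial.aeval ((1 / 2 : ℂ) • semicircularElt (h p.1))
    (Polynomial.Chebyshev.U ℂ ((p.2 : ℕ) : ℤ))).prod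

end Semicircular

end FreeFock

end

open MeasureTheory UniformSpace
open scoped TensorProduct ENNReal

noncomputable section

namespace FreeFock

/-! ### Creation operators on the full Fock space -/

section Fock

variable {K : Type} [NormedAddCommGroup K] [InnerProductSpace ℂ K]

/-! Since τ(x^*y) = ⟨xΩ, yΩ⟩, evaluation at Ω preserves inner products, so it suffices that the
vectors U_αΩ form an orthonormal basis of the Fock space (`orthonormal_toL2`, `closure_span_toL2`).
Let e_i be the complexified h_i, and let w be an elementary tensor of basis vectors not starting
with e_i. The annihilator of e_i kills w and strips one e_i from e_i^{⊗n} ⊗ w when n ≥ 1, so T_i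
sends this vector to e_i^{⊗(n+1)} ⊗ w + e_i^{⊗(n-1)} ⊗ w. This is the recurrence 2x U_n = U_{n+1} +
U_{n-1} at x = T_i/2, whence U_n(T_i/2) w = e_i^{⊗n} ⊗ w (`aeval_chebyshev_wordVec`). Reducedness of
α supplies the condition on w at every factor, so U_αΩ is the elementary tensor whose run-length
encoding is α (`chebyshevWord_vacuum`). Run-length encoding is a bijection between words and reduced
words, and the elementary tensors form an orthonormal basis (`orthonormal_wordVec`,
`closure_span_wordVec`). -/

theorem creation_apply_zero (k : K) (f : Fock K) : creation k f 0 = 0 := rfl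

theorem creation_apply_succ (k : K) (f : Fock K) (n : ℕ) :
    creation k f (n + 1) = tensorLeft k n (f n) := rfl

theorem tensorLeft_add (k k' : K) (n : ℕ) (x : TensorPow K n) :
    tensorLeft (k + k') n x = tensorLeft k n x + tensorLeft k' n x :=
  (congrArg ((↑) : K ⊗[ℂ] TensorPow K n → Completion (K ⊗[ℂ] TensorPow K n))
    (TensorProduct.add_tmul k k' x)).trans (Completion.coe_add _ _)

theorem tensorLeft_smul (c : ℂ) (k : K) (n : ℕ) (x : TensorPow K n) :
    tensorLeft (c • k) n x = c • tensorLeft k n x :=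
  (congrArg ((↑) : K ⊗[ℂ] TensorPow K n → Completion (K ⊗[ℂ] TensorPow K n))
    (TensorProduct.smul_tmul' c k x).symm).trans (Completion.coe_smul _ _)

theorem inner_tensorLeft (k k' : K) (n : ℕ) (x y : TensorPow K n) :
    inner ℂ (tensorLeft k n x) (tensorLeft k' n y) = inner ℂ k k' * inner ℂ x y := by
  change inner ℂ ((k ⊗ₜ[ℂ] x : K ⊗[ℂ] TensorPow K n) : Completion (K ⊗[ℂ] TensorPow K n))
    ((k' ⊗ₜ[ℂ] y : K ⊗[ℂ] TensorPow K n) : Completion (K ⊗[ℂ] TensorPow K n)) = _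
  rw [Completion.inner_coe, TensorProduct.inner_tmul]

theorem inner_creation_creation (k k' : K) (f g : Fock K) :
    inner ℂ (creation k f) (creation k' g) = inner ℂ k k' * inner ℂ f g := by
  have h1 := lp.hasSum_inner (𝕜 := ℂ) (creation k f) (creation k' g)
  have h2 := (lp.hasSum_inner (𝕜 := ℂ) f g).mul_left (inner ℂ k k')
  refine h1.unique ((hasSum_nat_add_iff' 1).mp ?_)
  simpa [creation_apply_zero, creation_apply_succ, inner_tensorLeft] using h2

theorem inner_vacuum_left (f : Fock K) :
    inner ℂ (vacuum K) f = inner ℂ (tensorUnit K) (f 0) :=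
  lp.inner_single_left 0 (tensorUnit K) f

theorem inner_vacuum_creation (k : K) (f : Fock K) :
    inner ℂ (vacuum K) (creation k f) = 0 := by
  rw [inner_vacuum_left, creation_apply_zero, inner_zero_right]

theorem inner_vacuum_vacuum : inner ℂ (vacuum K) (vacuum K) = (1 : ℂ) := by
  rw [inner_vacuum_left, vacuum, lp.single_apply_self]
  change inner ℂ (1 : ℂ) (1 : ℂ) = 1
  simp

theorem adjoint_creation_creation (k k' : K) (f : Fock K) :
    ContinuousLinearMap.adjoint (creation k) (creation k' f) = inner ℂ k k' • f := by
  refine ext_inner_left ℂ fun g => ?_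
  rw [ContinuousLinearMap.adjoint_inner_right, inner_creation_creation, inner_smul_right]

theorem adjoint_creation_vacuum (k : K) :
    ContinuousLinearMap.adjoint (creation k) (vacuum K) = 0 := by
  refine ext_inner_right ℂ fun g => ?_
  rw [ContinuousLinearMap.adjoint_inner_left, inner_vacuum_creation, inner_zero_left]

theorem norm_creation_apply_le (k : K) (f : Fock K) : ‖creation k f‖ ≤ ‖k‖ * ‖f‖ :=
  lp.norm_le_of_tsum_le (by simp) (by positivity) (hasSum_creationSeq k f).tsum_eq.le

/-- The creation operators applied to a fixed vector, as a bounded linear map. -/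
def creationFlip (f : Fock K) : K →L[ℂ] Fock K :=
  LinearMap.mkContinuous
    { toFun := fun k => creation k f
      map_add' := fun k k' => by
        ext n
        cases n with
        | zero => exact (add_zero 0).symm
        | succ n => exact tensorLeft_add k k' n (f n)
      map_smul' := fun c k => by
        ext n
        cases n with
        | zero => exact (smul_zero c).symm
        | succ n => exact tensorLeft_smul c k n (f n) }
    ‖f‖ fun k => (norm_creation_apply_le k f).trans_eq (mul_comm _ _)

theorem creationFlip_apply (f : Fock K) (k : K) : creationFlip f k = creation k f := rfl

theorem creation_single (k : K) (n : ℕ) (x : TensorPow K n) :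
    creation k (lp.single 2 n x) = lp.single 2 (n + 1) (tensorLeft k n x) := by
  ext m
  cases m with
  | zero =>
    rw [creation_apply_zero, lp.single_apply_ne]
    omega
  | succ m =>
    rw [creation_apply_succ]
    by_cases hm : m = n
    · subst hm
      rw [lp.single_apply_self, lp.single_apply_self]
    · rw [lp.single_apply_ne _ _ _ hm, lp.single_apply_ne _ _ _ (by omega), map_zero]

/-! ### The basis of words -/

variable {ι : Type*}

/-- The elementary tensor `e_{i_1} ⊗ ⋯ ⊗ e_{i_n}` as a vector of the full Fock space. -/
def wordVec (e : ι → K) : List ι → Fock K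
  | [] => vacuum K
  | i :: w => creation (e i) (wordVec e w)

/-- Peeling off first letters gives a product of Kronecker deltas; words of different lengths end by
pairing Ω with the range of a creation operator. -/
theorem orthonormal_wordVec {e : ι → K} (he : Orthonormal ℂ e) :
    Orthonormal ℂ (wordVec e) := by
  classical
  rw [orthonormal_iff_ite] at he ⊢
  intro v
  induction v with
  | nil =>
    intro w
    cases w with
    | nil => simpa [wordVec] using inner_vacuum_vacuum
    | cons j w => simpa [wordVec] using inner_vacuum_creation (e j) (wordVec e w)
  | cons i v ih =>
    intro w
    cases w with
    | nil =>
      simpa [wordVec] using inner_eq_zero_symm.mp (inner_vacuum_creation (e i) (wordVec e v))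
    | cons j w =>
      rw [wordVec, wordVec, inner_creation_creation, he, ih]
      by_cases hij : i = j <;> by_cases hvw : v = w <;> simp [hij, hvw]

/-- Two density arguments: in `f` with `k = e i`, where prefixing a letter sends words to words,
then in `k` with `f` fixed. -/
theorem creation_mem_closure_span_wordVec {e : ι → K}
    (he : (Submodule.span ℂ (Set.range e)).topologicalClosure = ⊤) (k : K) {f : Fock K}
    (hf : f ∈ (Submodule.span ℂ (Set.range (wordVec e))).topologicalClosure) :
    creation k f ∈ (Submodule.span ℂ (Set.range (wordVec e))).topologicalClosure := by
  set S := (Submodule.span ℂ (Set.range (wordVec e))).topologicalClosure with hS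
  have hSc : IsClosed (S : Set (Fock K)) := Submodule.isClosed_topologicalClosure _
  have h1 (i : ι) : S ≤ S.comap (creation (e i)).toLinearMap := by
    refine Submodule.topologicalClosure_minimal _ (Submodule.span_le.mpr ?_)
      (hSc.preimage (creation (e i)).continuous)
    rintro _ ⟨w, rfl⟩
    exact Submodule.le_topologicalClosure _ (Submodule.subset_span ⟨i :: w, rfl⟩)
  have h2 : (⊤ : Submodule ℂ K) ≤ S.comap (creationFlip f).toLinearMap := by
    rw [← he]
    refine Submodule.topologicalClosure_minimal _ (Submodule.span_le.mpr ?_)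
      (hSc.preimage (creationFlip f).continuous)
    rintro _ ⟨i, rfl⟩
    exact h1 i hf
  exact h2 (Submodule.mem_top (x := k))

theorem single_mem_closure_span_wordVec {e : ι → K}
    (he : (Submodule.span ℂ (Set.range e)).topologicalClosure = ⊤) (n : ℕ) (x : TensorPow K n) :
    (lp.single 2 n x : Fock K) ∈
      (Submodule.span ℂ (Set.range (wordVec e))).topologicalClosure := by
  induction n with
  | zero =>
    have hx : x = (show ℂ from x) • tensorUnit K := (mul_one (show ℂ from x)).symm
    rw [hx, lp.single_smul]
    exact Submodule.smul_mem _ _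
      (Submodule.le_topologicalClosure _ (Submodule.subset_span ⟨[], rfl⟩))
  | succ n ih =>
    set S := (Submodule.span ℂ (Set.range (wordVec e))).topologicalClosure with hS
    have hSc : IsClosed (S : Set (Fock K)) := Submodule.isClosed_topologicalClosure _
    -- Writing the domain as an explicit completion reduces the claim to algebraic tensors, then to
    -- simple ones.
    let L : Completion (K ⊗[ℂ] TensorPow K n) →L[ℂ] Fock K :=
      lp.singleContinuousLinearMap ℂ (fun n => TensorPow K n) 2 (n + 1)
    refine Completion.induction_on (p := fun y => L y ∈ S) x (hSc.preimage L.continuous)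
      fun t => ?_
    induction t using TensorProduct.induction_on with
    | zero =>
      rw [Completion.coe_zero, map_zero]
      exact S.zero_mem
    | tmul k y =>
      change (lp.single 2 (n + 1) (tensorLeft k n y) : Fock K) ∈ S
      rw [← creation_single]
      exact creation_mem_closure_span_wordVec he k (ih y)
    | add s t hs ht =>
      rw [Completion.coe_add, map_add]
      exact S.add_mem hs ht

theorem closure_span_wordVec {e : ι → K}
    (he : (Submodule.span ℂ (Set.range e)).topologicalClosure = ⊤) :
    (Submodule.span ℂ (Set.range (wordVec e))).topologicalClosure = ⊤ := by
  refine eq_top_iff.mpr fun f _ => ?_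
  have hf := lp.hasSum_single (p := 2) (by simp) f
  refine (Submodule.isClosed_topologicalClosure _).mem_of_tendsto hf (.of_forall fun s => ?_)
  exact Submodule.sum_mem _ fun n _ => single_mem_closure_span_wordVec he n _

/-! ### Chebyshev polynomials of field operators -/

theorem adjoint_creation_wordVec {e : ι → K} (he : Orthonormal ℂ e) {i : ι} {w : List ι}
    (hw : w.head? ≠ some i) :
    ContinuousLinearMap.adjoint (creation (e i)) (wordVec e w) = 0 := by
  cases w with
  | nil => exact adjoint_creation_vacuum _
  | cons j w =>
    have hij : i ≠ j := fun h => hw (by simp [h])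
    rw [wordVec, adjoint_creation_creation, he.2 hij, zero_smul]

theorem fieldOp_wordVec_of_head_ne {e : ι → K} (he : Orthonormal ℂ e) {i : ι} {w : List ι}
    (hw : w.head? ≠ some i) : fieldOp (e i) (wordVec e w) = wordVec e (i :: w) := by
  rw [fieldOp, add_apply, adjoint_creation_wordVec he hw, add_zero, wordVec]

theorem fieldOp_wordVec_cons {e : ι → K} (he : Orthonormal ℂ e) (i : ι) (w : List ι) :
    fieldOp (e i) (wordVec e (i :: w)) = wordVec e (i :: i :: w) + wordVec e w := by
  rw [fieldOp, add_apply, wordVec, adjoint_creation_creation,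
    inner_self_eq_norm_sq_to_K, he.1 i]
  simp [wordVec]

/-- The head condition matters only at `n = 1`; afterwards the contraction term is cancelled by the
`-U_n` of the recurrence. -/
theorem aeval_chebyshev_wordVec {e : ι → K} (he : Orthonormal ℂ e) {i : ι} {w : List ι}
    (hw : w.head? ≠ some i) (n : ℕ) :
    Polynomial.aeval ((1 / 2 : ℂ) • fieldOp (e i)) (Polynomial.Chebyshev.U ℂ (n : ℤ))
      (wordVec e w) = wordVec e (List.replicate n i ++ w) := by
  have two_mul_half : (2 : Fock K →L[ℂ] Fock K) * (1 / 2 : ℂ) • fieldOp (e i) = fieldOp (e i) := by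
    rw [two_mul, ← add_smul]
    norm_num
  have key (g : Fock K) (m : ℤ) :
      Polynomial.aeval ((1 / 2 : ℂ) • fieldOp (e i)) (Polynomial.Chebyshev.U ℂ (m + 2)) g =
        fieldOp (e i)
          (Polynomial.aeval ((1 / 2 : ℂ) • fieldOp (e i)) (Polynomial.Chebyshev.U ℂ (m + 1)) g) -
        Polynomial.aeval ((1 / 2 : ℂ) • fieldOp (e i)) (Polynomial.Chebyshev.U ℂ m) g := by
    rw [Polynomial.Chebyshev.U_add_two, map_sub, map_mul, map_mul, Polynomial.aeval_X, map_ofNat,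
      two_mul_half]
    rfl
  induction n using Nat.twoStepInduction with
  | zero => simp
  | one =>
    rw [Nat.cast_one, Polynomial.Chebyshev.U_one, map_mul, map_ofNat, Polynomial.aeval_X,
      two_mul_half, fieldOp_wordVec_of_head_ne he hw]
    rfl
  | more n ih0 ih1 =>
    have h := key (wordVec e w) n
    push_cast at ih1 ⊢
    rw [h, ih1, ih0, List.replicate_succ, List.cons_append, fieldOp_wordVec_cons he]
    simp [List.replicate_succ]

end Fock

/-! ### Run-length encoding of words -/

section Words

variable {ι : Type*}

/-- The word `i_1 ⋯ i_1 i_2 ⋯ i_2 ⋯`, with each letter `i_j` repeated `α_j` times. -/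
def expand : List (ι × ℕ+) → List ι
  | [] => []
  | p :: w => List.replicate p.2 p.1 ++ expand w

theorem head?_expand (w : List (ι × ℕ+)) : (expand w).head? = w.head?.map Prod.fst := by
  cases w with
  | nil => rfl
  | cons p w =>
    obtain ⟨m, hm⟩ := Nat.exists_eq_succ_of_ne_zero p.2.ne_zero
    simp [expand, hm, List.replicate_succ]

theorem head?_expand_ne_of_isChain_cons {p : ι × ℕ+} {w : List (ι × ℕ+)}
    (h : (p :: w).IsChain (fun a b => a.1 ≠ b.1)) : (expand w).head? ≠ some p.1 := by
  rw [head?_expand]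
  cases w with
  | nil => simp
  | cons q w =>
    have := (List.isChain_cons_cons.mp h).1
    simpa using this.symm

/-- The head conditions make both initial runs of `i` maximal, so their lengths are determined by
the word. -/
theorem replicate_append_inj {i : ι} {u v : List ι} (hu : u.head? ≠ some i)
    (hv : v.head? ≠ some i) {m n : ℕ}
    (h : List.replicate m i ++ u = List.replicate n i ++ v) : m = n ∧ u = v := by
  induction m generalizing n with
  | zero =>
    cases n with
    | zero => simpa using h
    | succ n => exact absurd (by simp_all [List.replicate_succ]) hu
  | succ m ih =>
    cases n with
    | zero =>
      rw [List.replicate_zero, List.nil_append] at h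
      exact absurd (by simp [← h, List.replicate_succ]) hv
    | succ n =>
      simp only [List.replicate_succ, List.cons_append, List.cons.injEq, true_and] at h
      exact ⟨congrArg Nat.succ (ih h).1, (ih h).2⟩

theorem expand_inj_of_isChain {v w : List (ι × ℕ+)} (hv : v.IsChain (fun a b => a.1 ≠ b.1))
    (hw : w.IsChain (fun a b => a.1 ≠ b.1)) (h : expand v = expand w) : v = w := by
  induction v generalizing w with
  | nil =>
    cases w with
    | nil => rfl
    | cons q w =>
      have := congrArg List.head? h
      simp [head?_expand] at this
  | cons p v ih =>
    cases w with
    | nil =>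
      have := congrArg List.head? h
      simp [head?_expand] at this
    | cons q w =>
      have hpq : p.1 = q.1 := by
        have := congrArg List.head? h
        simpa [head?_expand] using this
      have h1 := head?_expand_ne_of_isChain_cons hv
      have h2 := head?_expand_ne_of_isChain_cons hw
      rw [expand, expand, ← hpq] at h
      rw [← hpq] at h2
      obtain ⟨h3, h4⟩ := replicate_append_inj h1 h2 h
      have h5 : v = w := ih hv.tail hw.tail h4
      rw [h5, Prod.ext hpq (PNat.coe_injective h3)]

theorem expand_injective : Function.Injective fun α : ReducedWord ι => expand α.1 :=
  fun α β h => Subtype.ext (expand_inj_of_isChain α.2 β.2 h)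

/-- Prefixing a letter either lengthens the leading run or opens a new run of length one. -/
theorem expand_surjective : Function.Surjective fun α : ReducedWord ι => expand α.1 := by
  intro w
  induction w with
  | nil => exact ⟨⟨[], List.isChain_nil⟩, rfl⟩
  | cons i w ih =>
    obtain ⟨⟨v, hv⟩, rfl⟩ := ih
    cases v with
    | nil => exact ⟨⟨[(i, 1)], List.isChain_singleton _⟩, rfl⟩
    | cons p v =>
      by_cases hi : i = p.1
      · refine ⟨⟨(p.1, p.2 + 1) :: v, ?_⟩, ?_⟩
        · cases v with
          | nil => exact List.isChain_singleton _
          -- The chain relation sees only letters, so raising an exponent preserves it.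
          | cons q v =>
            rw [List.isChain_cons_cons] at hv ⊢
            exact hv
        · simp [expand, hi, List.replicate_succ]
      · exact ⟨⟨(i, 1) :: p :: v, List.isChain_cons_cons.mpr ⟨hi, hv⟩⟩, rfl⟩

end Words

/-! ### Bases of the `L₂` space of a vector state -/

section VN

universe u
variable {E : Type u} [NormedAddCommGroup E] [InnerProductSpace ℂ E] [CompleteSpace E]

theorem inner_toPreL2 (M : VonNeumannAlgebra E) (ω : E) (x y : M.toStarSubalgebra) :
    inner ℂ (toPreL2 M ω x) (toPreL2 M ω y) =
      inner ℂ ((x : E →L[ℂ] E) ω) ((y : E →L[ℂ] E) ω) :=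
  vectorState_star_mul M ω x y

theorem inner_toL2 (M : VonNeumannAlgebra E) (ω : E) (x y : M.toStarSubalgebra) :
    inner ℂ (toL2 M ω x) (toL2 M ω y) =
      inner ℂ ((x : E →L[ℂ] E) ω) ((y : E →L[ℂ] E) ω) := by
  rw [toL2, toL2, Completion.inner_coe, inner_toPreL2]

theorem norm_toPreL2 (M : VonNeumannAlgebra E) (ω : E) (x : M.toStarSubalgebra) :
    ‖toPreL2 M ω x‖ = ‖(x : E →L[ℂ] E) ω‖ := by
  rw [@norm_eq_sqrt_re_inner ℂ, @norm_eq_sqrt_re_inner ℂ, inner_toPreL2]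

theorem orthonormal_toL2 {κ : Type*} (M : VonNeumannAlgebra E) (ω : E)
    {x : κ → M.toStarSubalgebra} (hx : Orthonormal ℂ fun a => (x a : E →L[ℂ] E) ω) :
    Orthonormal ℂ fun a => toL2 M ω (x a) := by
  classical
  rw [orthonormal_iff_ite] at hx ⊢
  intro a b
  rw [inner_toL2, hx]

/-- `M` is dense in its completion, and the norm of `y` there is ‖yω‖, so approximating yω by
combinations of the x_a ω approximates `y` equally well. -/
theorem closure_span_toL2 {κ : Type*} (M : VonNeumannAlgebra E) (ω : E)
    {x : κ → M.toStarSubalgebra}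
    (hx : (Submodule.span ℂ (Set.range fun a => (x a : E →L[ℂ] E) ω)).topologicalClosure = ⊤) :
    (Submodule.span ℂ (Set.range fun a => toL2 M ω (x a))).topologicalClosure = ⊤ := by
  set S := (Submodule.span ℂ (Set.range fun a => toL2 M ω (x a))).topologicalClosure with hS
  have hSc : IsClosed (S : Set (L2 M ω)) := Submodule.isClosed_topologicalClosure _
  let evalMap : M.toStarSubalgebra →ₗ[ℂ] E :=
    { toFun := fun y => (y : E →L[ℂ] E) ω
      map_add' := fun _ _ => rfl
      map_smul' := fun _ _ => rfl }
  let L2Map : M.toStarSubalgebra →ₗ[ℂ] L2 M ω :=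
    (Completion.toComplL : PreL2 M ω →L[ℂ] Completion (PreL2 M ω)).toLinearMap ∘ₗ
      (toPreL2 M ω).toLinearMap
  have hnorm (y : M.toStarSubalgebra) : ‖L2Map y‖ = ‖evalMap y‖ := by
    change ‖(toPreL2 M ω y : Completion (PreL2 M ω))‖ = _
    rw [Completion.norm_coe, norm_toPreL2]
    rfl
  have h1 : Submodule.span ℂ (Set.range fun a => (x a : E →L[ℂ] E) ω) =
      (Submodule.span ℂ (Set.range x)).map evalMap := by
    rw [Submodule.map_span, ← Set.range_comp]
    rfl
  have h2 : Submodule.span ℂ (Set.range fun a => toL2 M ω (x a)) =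
      (Submodule.span ℂ (Set.range x)).map L2Map := by
    rw [Submodule.map_span, ← Set.range_comp]
    rfl
  refine eq_top_iff.mpr fun z _ => ?_
  refine Completion.induction_on (p := fun z => z ∈ S) z hSc fun y => ?_
  obtain ⟨y, rfl⟩ := (toPreL2 M ω).surjective y
  change L2Map y ∈ closure _
  refine Metric.mem_closure_iff.mpr fun ε hε => ?_
  have hy : evalMap y ∈ (Submodule.span ℂ
      (Set.range fun a => (x a : E →L[ℂ] E) ω)).topologicalClosure := hx ▸ Submodule.mem_top
  obtain ⟨_, hb, hlt⟩ := Metric.mem_closure_iff.mp hy ε hε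
  rw [h1] at hb
  obtain ⟨b, hb, rfl⟩ := hb
  refine ⟨L2Map b, h2 ▸ Submodule.mem_map_of_mem hb, ?_⟩
  rwa [dist_eq_norm, ← map_sub, hnorm, map_sub, ← dist_eq_norm]

end VN

/-! ### Complexification of an orthonormal basis -/

section Semicircular

variable {σ : Measure ℝ}

theorem inner_complexify (f g : Lp ℝ 2 σ) :
    inner ℂ (complexify σ f) (complexify σ g) = ((inner ℝ f g : ℝ) : ℂ) := by
  rw [L2.inner_def, L2.inner_def]
  refine (integral_congr_ae ?_).trans integral_complex_ofReal
  filter_upwards [Complex.ofRealCLM.coeFn_compLp f, Complex.ofRealCLM.coeFn_compLp g] with u hf hg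
  change inner ℂ (Complex.ofRealCLM.compLp f u) (Complex.ofRealCLM.compLp g u) = _
  rw [hf, hg]
  simp

theorem complexify_re_add_im (F : Lp ℂ 2 σ) :
    F = complexify σ (Complex.reCLM.compLp F) +
      Complex.I • complexify σ (Complex.imCLM.compLp F) := by
  refine Lp.ext ?_
  filter_upwards [Lp.coeFn_add (complexify σ (Complex.reCLM.compLp F))
      (Complex.I • complexify σ (Complex.imCLM.compLp F)),
    Lp.coeFn_smul Complex.I (complexify σ (Complex.imCLM.compLp F)),
    Complex.ofRealCLM.coeFn_compLp (Complex.reCLM.compLp F),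
    Complex.ofRealCLM.coeFn_compLp (Complex.imCLM.compLp F),
    Complex.reCLM.coeFn_compLp F, Complex.imCLM.coeFn_compLp F] with u h1 h2 h3 h4 h5 h6
  rw [h1, Pi.add_apply, h2, Pi.smul_apply]
  change _ = Complex.ofRealCLM.compLp (Complex.reCLM.compLp F) u +
    Complex.I • Complex.ofRealCLM.compLp (Complex.imCLM.compLp F) u
  rw [h3, h4, h5, h6]
  simp [mul_comm Complex.I]

variable {ι : Type*}

theorem orthonormal_complexify {h : ι → Lp ℝ 2 σ} (hh : Orthonormal ℝ h) :
    Orthonormal ℂ fun i => complexify σ (h i) := by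
  classical
  rw [orthonormal_iff_ite] at hh ⊢
  intro i j
  rw [inner_complexify, hh]
  split_ifs <;> simp

/-- The closed complex span contains every complexified real function by real density, hence every F
= Re F + i Im F. -/
theorem closure_span_complexify {h : ι → Lp ℝ 2 σ}
    (hh : (Submodule.span ℝ (Set.range h)).topologicalClosure = ⊤) :
    (Submodule.span ℂ (Set.range fun i => complexify σ (h i))).topologicalClosure = ⊤ := by
  set S := (Submodule.span ℂ (Set.range fun i => complexify σ (h i))).topologicalClosure with hS
  have hSc : IsClosed (S : Set (Lp ℂ 2 σ)) := Submodule.isClosed_topologicalClosure _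
  have h1 : (⊤ : Submodule ℝ (Lp ℝ 2 σ)) ≤
      (S.restrictScalars ℝ).comap (complexify σ).toLinearMap := by
    rw [← hh]
    refine Submodule.topologicalClosure_minimal _ (Submodule.span_le.mpr ?_)
      (hSc.preimage (complexify σ).continuous)
    rintro _ ⟨i, rfl⟩
    exact Submodule.le_topologicalClosure _ (Submodule.subset_span ⟨i, rfl⟩)
  refine eq_top_iff.mpr fun F _ => ?_
  rw [complexify_re_add_im F]
  exact S.add_mem (h1 Submodule.mem_top) (S.smul_mem _ (h1 Submodule.mem_top))

/-! ### Chebyshev words applied to the vacuum -/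

theorem coe_aeval_semicircularElt (g : Lp ℝ 2 σ) (p : Polynomial ℂ) :
    ((Polynomial.aeval ((1 / 2 : ℂ) • semicircularElt g) p : (freeAlg σ).toStarSubalgebra) :
        FockSigma σ →L[ℂ] FockSigma σ) =
      Polynomial.aeval ((1 / 2 : ℂ) • fieldOp (complexify σ g)) p :=
  (Polynomial.aeval_algHom_apply (freeAlg σ).toStarSubalgebra.subtype.toAlgHom
    ((1 / 2 : ℂ) • semicircularElt g) p).symm

theorem chebyshevWord_vacuum {h : ι → Lp ℝ 2 σ} (hh : Orthonormal ℝ h) (α : ReducedWord ι) :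
    (chebyshevWord h α : FockSigma σ →L[ℂ] FockSigma σ) (vacuum (Lp ℂ 2 σ)) =
      wordVec (fun i => complexify σ (h i)) (expand α.1) := by
  obtain ⟨w, hw⟩ := α
  induction w with
  | nil => rfl
  | cons p w ih =>
    have hmul : chebyshevWord h ⟨p :: w, hw⟩ =
        Polynomial.aeval ((1 / 2 : ℂ) • semicircularElt (h p.1))
          (Polynomial.Chebyshev.U ℂ ((p.2 : ℕ) : ℤ)) * chebyshevWord h ⟨w, hw.tail⟩ :=
      List.prod_cons
    rw [hmul, MulMemClass.coe_mul, mul_apply_eq_comp, coe_aeval_semicircularElt,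
      ih hw.tail]
    -- Operators act from the right, so the tail has already produced a word; the chain condition
    -- makes its first letter differ from `p.1`.
    exact aeval_chebyshev_wordVec (orthonormal_complexify hh)
      (head?_expand_ne_of_isChain_cons hw) p.2

end Semicircular

end FreeFock

end

theorem theorem4p2 (σ : Measure ℝ)
    (hσ : ∃ N : ℕ, ∫⁻ u : ℝ, ENNReal.ofReal (1 / (u ^ 2 + 1) ^ N) ∂σ < ∞)
    {ι : Type*} (h : HilbertBasis ι ℝ (Lp ℝ 2 σ)) :
    ∃ b : HilbertBasis (FreeFock.ReducedWord ι) ℂ (FreeFock.L2tau σ),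
      ∀ α : FreeFock.ReducedWord ι,
        b α = FreeFock.toL2 (FreeFock.freeAlg σ) (FreeFock.vacuum (Lp ℂ 2 σ))
          (FreeFock.chebyshevWord (fun i => h i) α) := by
  have heq : (fun α : FreeFock.ReducedWord ι =>
      (FreeFock.chebyshevWord (fun i => h i) α : FreeFock.FockSigma σ →L[ℂ] FreeFock.FockSigma σ)
        (FreeFock.vacuum (Lp ℂ 2 σ))) =
      FreeFock.wordVec (fun i => FreeFock.complexify σ (h i)) ∘ fun α => FreeFock.expand α.1 :=
    funext (FreeFock.chebyshevWord_vacuum h.orthonormal)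
  have hon := FreeFock.orthonormal_toL2 (FreeFock.freeAlg σ) (FreeFock.vacuum (Lp ℂ 2 σ))
    (x := FreeFock.chebyshevWord fun i => h i) (by
      rw [heq]
      exact (FreeFock.orthonormal_wordVec (FreeFock.orthonormal_complexify h.orthonormal)).comp _
        FreeFock.expand_injective)
  have htot := FreeFock.closure_span_toL2 (FreeFock.freeAlg σ) (FreeFock.vacuum (Lp ℂ 2 σ))
    (x := FreeFock.chebyshevWord fun i => h i) (by
      rw [heq, FreeFock.expand_surjective.range_comp]
      exact FreeFock.closure_span_wordVec (FreeFock.closure_span_complexify h.dense_span))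
  exact ⟨HilbertBasis.mk hon htot.ge, fun α => by rw [HilbertBasis.coe_mk]⟩
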